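/- Let $\boldsymbol\pi=(\pi_0,\pi_1,\dots)$ be a probability distribution on $\{0,1,2,\dots\}$ (the prior, $\pi_n=\mathbb P(N=n)$, of the number $N$ of trials), and let $\boldsymbol p=(p_1,p_2,\dots)$ be a profile of success probabilities with $p_1=1$ and $0<p_k<1$ for $k>1$. For $k\ge 1$ and $n\ge k$ put $$s_0(k+1,n)=\prod_{j=k+1}^n(1-p_j),\qquad s_1(k+1,n)=s_0(k+1,n)\sum_{j=k+1}^n\frac{p_j}{1-p_j}$$ (so $s_0(k+1,k)=1$ and $s_1(k+1,k)=0$); these are the probabilities of zero, respectively one, success among the independent trials $k+1,\dots,n$. Let $$f_k(t)=\Big(\sum_{j=0}^\infty \pi_{k+j}\binom{k+j}{k}(1-t)^j\Big)^{-1},$$ $$\mathcal S_0(t,k)=f_k(t)\sum_{j=0}^\infty \pi_{k+j}\binom{k+j}{k}(1-t)^j s_0(k+1,k+j),$$ $$\mathcal S_1(t,k)=f_k(t)\sum_{j=1}^\infty \pi_{k+j}\binom{k+j}{k}(1-t)^j s_1(k+1,k+j).$$ When the $N$ trials occur at independent uniform times on $[0,1]$ and $N_t$ is the number of trials in $[0,t]$,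 these are, for $t>0$, the conditional probabilities given $N_t=k$ that exactly zero, respectively exactly one, of the trials after time $t$ is a success. Fix $k\ge1$ and suppose $\pi_k>0$. Let $D_k$ be the set of all $t\in[0,1]$ for which $\sum_{j}\pi_{k+j}\binom{k+j}{k}(1-t)^j<\infty$. Then $(0,1]\subseteq D_k$, all the series above converge for $t\in D_k$, and: (i) $\mathcal S_0(1,k)=1$ and $\mathcal S_1(1,k)=0$; (ii) $\mathcal S_0(t,k)$ is nondecreasing in $t\in D_k$, and it is strictly increasing in $t\in D_k$ if $\mathbb P(N>k)=\sum_{j=k+1}^\infty\pi_j>0$; (iii) there exists $a_k\in[0,1)$ such that $\operatorname{sgn}\big(\mathcal S_0(t,k)-\mathcal S_1(t,k)\big)=\operatorname{sgn}(t-a_k)$ for all $t\in(0,1]$. -/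

import Mathlib

namespace LastSuccess

/-- The distribution `π n = P(N = n)` of the number `N` of trials: a probability distribution
on `{0, 1, 2, …}`. -/
structure IsPrior (π : ℕ → ℝ) : Prop where
  nonneg : ∀ n, 0 ≤ π n
  hasSum_one : HasSum π 1

/-- A profile of success probabilities `p 1, p 2, …` (the value `p 0` plays no role). -/
structure IsSuccessProfile (p : ℕ → ℝ) : Prop where
  first : p 1 = 1
  pos : ∀ k, 1 < k → 0 < p k
  lt_one : ∀ k, 1 < k → p k < 1

/-- Probability of zero successes among the trials `m, …, n` (an empty product is `1`). -/
noncomputable def s0 (p : ℕ → ℝ) (m n : ℕ) : ℝ :=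
  ∏ j ∈ Finset.Icc m n, (1 - p j)

/-- Probability of exactly one success among the trials `m, …, n`, for `m ≥ 2`
(an empty sum is `0`). -/
noncomputable def s1 (p : ℕ → ℝ) (m n : ℕ) : ℝ :=
  s0 p m n * ∑ j ∈ Finset.Icc m n, p j / (1 - p j)

/-- The unnormalised posterior weight of `N = k + j` in the state `N_t = k`. -/
noncomputable def weight (π : ℕ → ℝ) (k : ℕ) (t : ℝ) (j : ℕ) : ℝ :=
  π (k + j) * ((k + j).choose k : ℝ) * (1 - t) ^ j

/-- The times `t ∈ [0, 1]` at which the posterior weights have a finite sum, so that they can be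
normalised to a probability distribution (when `π k > 0`). -/
def posteriorTimes (π : ℕ → ℝ) (k : ℕ) : Set ℝ :=
  {t | t ∈ Set.Icc (0 : ℝ) 1 ∧ Summable (weight π k t)}

/-- The normalisation function `f_k(t)` of the posterior
`P(N = k + j | N_t = k) = f_k(t) * weight π k t j`, `j ≥ 0`. -/
noncomputable def normalisation (π : ℕ → ℝ) (k : ℕ) (t : ℝ) : ℝ :=
  (∑' j : ℕ, weight π k t j)⁻¹

/-- Conditional probability that no success follows the state `(t, k)`. -/
noncomputable def S0 (π p : ℕ → ℝ) (t : ℝ) (k : ℕ) : ℝ :=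
  normalisation π k t * ∑' j : ℕ, weight π k t j * s0 p (k + 1) (k + j)

/-- Conditional probability that exactly one success follows the state `(t, k)`, `k ≥ 1`.
The sum runs over `j + 1 = 1, 2, …`. -/
noncomputable def S1 (π p : ℕ → ℝ) (t : ℝ) (k : ℕ) : ℝ :=
  normalisation π k t * ∑' j : ℕ, weight π k t (j + 1) * s1 p (k + 1) (k + (j + 1))

end LastSuccess

namespace LastSuccess

/-! In the variable `u = 1 - t`, both the monotonicity and the sign claim concern series `∑ c j * u
^ j * e j` with `c ≥ 0` and `e` antitone, `e 0 > 0`. Shrinking `v` to `u` damps the late,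
nonpositive terms more than the early, positive ones, so a sum that is nonnegative at `v` is
positive at `u` (`tsum_pos_of_single_crossing`). Monotonicity takes `e j = s0 - S0 π p t k`, whose
weighted sum vanishes at `t` and is therefore positive at any later time. The sign claim takes `e j
= 1 - ∑ p i / (1 - p i)`, since `s0 - s1 = s0 * e j`; a zero, if any, comes from the intermediate
value theorem. -/

/-- A power series whose coefficients change sign at most once, from positive to negative, and
which is nonnegative at `v` is positive on `[0, v)`. -/
theorem tsum_pos_of_single_crossing {c e : ℕ → ℝ} (hc : ∀ j, 0 ≤ c j) (he : Antitone e)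
    (hc0 : 0 < c 0) (he0 : 0 < e 0) {u v : ℝ} (hu : 0 ≤ u) (huv : u < v)
    (su : Summable fun j => c j * u ^ j * e j) (sv : Summable fun j => c j * v ^ j * e j)
    (hv : 0 ≤ ∑' j, c j * v ^ j * e j) : 0 < ∑' j, c j * u ^ j * e j := by
  have hvpos : 0 < v := hu.trans_lt huv
  by_cases h : ∀ j, 0 < e j
  · exact su.tsum_pos (fun j => by have := h j; have := hc j; positivity) 0 (by
      simpa using mul_pos hc0 he0)
  push Not at h
  classical
  obtain ⟨m, hm, hmin⟩ : ∃ m, e m ≤ 0 ∧ ∀ j < m, 0 < e j :=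
    ⟨Nat.find h, Nat.find_spec h, fun j hj => not_le.mp (Nat.find_min h hj)⟩
  have hm0 : m ≠ 0 := by rintro rfl; exact absurd hm (not_le.mpr he0)
  obtain ⟨q, rfl⟩ : ∃ q, u = q * v := ⟨u / v, by field_simp⟩
  have hq0 : 0 ≤ q := nonneg_of_mul_nonneg_left hu hvpos
  have hq1 : q < 1 := by nlinarith
  -- `q ^ j - q ^ m` and `e j` both pass from nonnegative to nonpositive at `j = m`, so their
  -- product is never negative.
  have key : ∀ j, q ^ m * (c j * v ^ j * e j) ≤ c j * (q * v) ^ j * e j := by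
    intro j
    have h1 : 0 ≤ (q ^ j - q ^ m) * e j := by
      rcases lt_or_ge j m with hj | hj
      · exact mul_nonneg (sub_nonneg.2 (pow_le_pow_of_le_one hq0 hq1.le hj.le)) (hmin j hj).le
      · exact mul_nonneg_of_nonpos_of_nonpos
          (sub_nonpos.2 (pow_le_pow_of_le_one hq0 hq1.le hj)) ((he hj).trans hm)
    have h2 : 0 ≤ c j * v ^ j * ((q ^ j - q ^ m) * e j) :=
      mul_nonneg (mul_nonneg (hc j) (by positivity)) h1
    rw [mul_pow]
    linarith
  have hlt : ∑' j, q ^ m * (c j * v ^ j * e j) < ∑' j, c j * (q * v) ^ j * e j := by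
    -- Strictness comes from the term `j = 0`, because `m ≠ 0` gives `q ^ m < 1`.
    refine Summable.tsum_lt_tsum (i := 0) key ?_ (sv.mul_left _) su
    have : q ^ m < 1 := pow_lt_one₀ hq0 hq1 hm0
    have : 0 < c 0 * e 0 := mul_pos hc0 he0
    simp only [pow_zero, mul_one]
    nlinarith
  rw [tsum_mul_left] at hlt
  exact lt_of_le_of_lt (mul_nonneg (by positivity) hv) hlt

theorem continuousOn_tsum_mul_pow {d : ℕ → ℝ} {v : ℝ} (sv : Summable fun j => d j * v ^ j) :
    ContinuousOn (fun u : ℝ => ∑' j, d j * u ^ j) (Set.Icc 0 v) := by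
  refine continuousOn_tsum (u := fun j => |d j * v ^ j|) (fun j => by fun_prop) sv.abs ?_
  intro j x hx
  rw [Real.norm_eq_abs, abs_mul, abs_mul, abs_of_nonneg (pow_nonneg hx.1 j),
    abs_of_nonneg (pow_nonneg (hx.1.trans hx.2) j)]
  exact mul_le_mul_of_nonneg_left (pow_le_pow_left₀ hx.1 hx.2 j) (abs_nonneg _)

/-- Sign pattern on `[0, 1)` of a power series with a single sign change in its coefficients. -/
theorem exists_sign_tsum_eq {c e : ℕ → ℝ} (hc : ∀ j, 0 ≤ c j) (he : Antitone e)
    (hc0 : 0 < c 0) (he0 : 0 < e 0)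
    (hs : ∀ u ∈ Set.Ico (0 : ℝ) 1, Summable fun j => c j * u ^ j * e j) :
    ∃ b ∈ Set.Ioc (0 : ℝ) 1, ∀ u ∈ Set.Ico (0 : ℝ) 1,
      SignType.sign (∑' j, c j * u ^ j * e j) = SignType.sign (b - u) := by
  by_cases h : ∀ u ∈ Set.Ico (0 : ℝ) 1, 0 < ∑' j, c j * u ^ j * e j
  -- With no sign change inside `[0, 1)`, the crossing is placed at the excluded endpoint.
  · refine ⟨1, by simp, fun u hu => ?_⟩
    rw [sign_pos (h u hu), sign_pos (sub_pos.2 hu.2)]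
  push Not at h
  obtain ⟨v, hv, hgv⟩ := h
  have heq : ∀ u : ℝ, (fun j => c j * u ^ j * e j) = fun j => c j * e j * u ^ j :=
    fun u => funext fun j => by ring
  have hcont : ContinuousOn (fun u : ℝ => ∑' j, c j * u ^ j * e j) (Set.Icc 0 v) := by
    simp only [heq]
    exact continuousOn_tsum_mul_pow (heq v ▸ hs v hv)
  have hg0 : 0 < ∑' j, c j * (0 : ℝ) ^ j * e j := by
    rw [tsum_eq_single 0 (fun j hj => by simp [hj])]
    simpa using mul_pos hc0 he0
  obtain ⟨b, hb, hgb⟩ := intermediate_value_Icc' hv.1 hcont ⟨hgv, hg0.le⟩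
  simp only at hgb
  have hb1 : b < 1 := hb.2.trans_lt hv.2
  have hb0 : 0 < b := by
    refine lt_of_le_of_ne hb.1 ?_
    rintro rfl
    exact hg0.ne' hgb
  refine ⟨b, ⟨hb0, hb1.le⟩, fun u hu => ?_⟩
  have sb := hs b ⟨hb.1, hb1⟩
  rcases lt_trichotomy u b with hub | rfl | hub
  · rw [sign_pos (sub_pos.2 hub), sign_pos
      (tsum_pos_of_single_crossing hc he hc0 he0 hu.1 hub (hs u hu) sb hgb.ge)]
  · rw [hgb, sub_self]
  · have : ∑' j, c j * u ^ j * e j < 0 := by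
      by_contra hcon
      have := tsum_pos_of_single_crossing hc he hc0 he0 hb.1 hub sb (hs u hu) (not_lt.1 hcon)
      exact this.ne' hgb
    rw [sign_neg (sub_neg.2 hub), sign_neg this]

/-! ### Zero or one success among the trials after `k` -/

section Profile

variable {p : ℕ → ℝ} {k : ℕ}

theorem s0_zero : s0 p (k + 1) (k + 0) = 1 := by simp [s0]

theorem s0_succ (j : ℕ) :
    s0 p (k + 1) (k + (j + 1)) = s0 p (k + 1) (k + j) * (1 - p (k + j + 1)) := by
  rw [s0, ← add_assoc, Finset.prod_Icc_succ_top (by lia)]; rfl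

theorem s1_zero : s1 p (k + 1) (k + 0) = 0 := by simp [s1]

theorem s0_pos (hp : IsSuccessProfile p) (hk : 1 ≤ k) (j : ℕ) : 0 < s0 p (k + 1) (k + j) := by
  refine Finset.prod_pos fun i hi => ?_
  rw [Finset.mem_Icc] at hi
  exact sub_pos.2 (hp.lt_one i (by lia))

theorem s0_succ_lt (hp : IsSuccessProfile p) (hk : 1 ≤ k) (j : ℕ) :
    s0 p (k + 1) (k + (j + 1)) < s0 p (k + 1) (k + j) := by
  rw [s0_succ]
  have := s0_pos hp hk j
  have := hp.pos (k + j + 1) (by lia)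
  nlinarith

theorem s0_strictAnti (hp : IsSuccessProfile p) (hk : 1 ≤ k) :
    StrictAnti fun j => s0 p (k + 1) (k + j) :=
  strictAnti_nat_of_succ_lt (s0_succ_lt hp hk)

theorem s0_le_one (hp : IsSuccessProfile p) (hk : 1 ≤ k) (j : ℕ) : s0 p (k + 1) (k + j) ≤ 1 :=
  ((s0_strictAnti hp hk).antitone (Nat.zero_le j)).trans_eq s0_zero

theorem odds_monotone (hp : IsSuccessProfile p) (hk : 1 ≤ k) :
    Monotone fun j => ∑ i ∈ Finset.Icc (k + 1) (k + j), p i / (1 - p i) := by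
  intro a b hab
  refine Finset.sum_le_sum_of_subset_of_nonneg
    (Finset.Icc_subset_Icc le_rfl (by lia)) fun i hi _ => ?_
  rw [Finset.mem_Icc] at hi
  exact div_nonneg (hp.pos i (by lia)).le (sub_nonneg.2 (hp.lt_one i (by lia)).le)

theorem s1_nonneg (hp : IsSuccessProfile p) (hk : 1 ≤ k) (j : ℕ) :
    0 ≤ s1 p (k + 1) (k + j) := by
  refine mul_nonneg (s0_pos hp hk j).le ?_
  simpa using odds_monotone hp hk (Nat.zero_le j)

theorem s1_succ (hp : IsSuccessProfile p) (hk : 1 ≤ k) (j : ℕ) :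
    s1 p (k + 1) (k + (j + 1)) =
      s1 p (k + 1) (k + j) * (1 - p (k + j + 1)) + s0 p (k + 1) (k + j) * p (k + j + 1) := by
  have h : 1 - p (k + j + 1) ≠ 0 := (sub_pos.2 (hp.lt_one (k + j + 1) (by lia))).ne'
  rw [s1, s0_succ, ← add_assoc, Finset.sum_Icc_succ_top (by lia), s1]
  field_simp

/-- Each further trial lowers the sum by `s1 * p`. The resulting bound on `s1` lets the weights
dominate its series. -/
theorem s0_add_s1_le_one (hp : IsSuccessProfile p) (hk : 1 ≤ k) (j : ℕ) :
    s0 p (k + 1) (k + j) + s1 p (k + 1) (k + j) ≤ 1 := by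
  induction j with
  | zero => rw [s0_zero, s1_zero, add_zero]
  | succ j ih =>
    rw [s0_succ, s1_succ hp hk]
    have := mul_nonneg (s1_nonneg hp hk j) (hp.pos (k + j + 1) (by lia)).le
    linarith

theorem s1_le_one (hp : IsSuccessProfile p) (hk : 1 ≤ k) (j : ℕ) : s1 p (k + 1) (k + j) ≤ 1 := by
  linarith [s0_add_s1_le_one hp hk j, s0_pos hp hk j]

end Profile

/-! ### Posterior averages of `s0` and `s1` -/

section Posterior

variable {π p : ℕ → ℝ} {k : ℕ} {t : ℝ}

theorem IsPrior.le_one (hπ : IsPrior π) (n : ℕ) : π n ≤ 1 :=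
  le_hasSum hπ.hasSum_one n fun i _ => hπ.nonneg i

theorem weight_nonneg (hπ : IsPrior π) (ht : t ≤ 1) (j : ℕ) : 0 ≤ weight π k t j :=
  mul_nonneg (mul_nonneg (hπ.nonneg _) (Nat.cast_nonneg _)) (pow_nonneg (sub_nonneg.2 ht) j)

theorem weight_zero : weight π k t 0 = π k := by simp [weight]

theorem weight_pos {j : ℕ} (hj : 0 < π (k + j)) (ht : t < 1) : 0 < weight π k t j :=
  mul_pos (mul_pos hj (Nat.cast_pos.2 (Nat.choose_pos (by lia)))) (pow_pos (sub_pos.2 ht) j)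

theorem Ioc_subset_posteriorTimes (hπ : IsPrior π) : Set.Ioc (0 : ℝ) 1 ⊆ posteriorTimes π k := by
  intro t ht
  refine ⟨⟨ht.1.le, ht.2⟩, ?_⟩
  have hn : ‖1 - t‖ < 1 := by
    rw [Real.norm_eq_abs, abs_of_nonneg (sub_nonneg.2 ht.2)]; linarith [ht.1]
  -- As `π ≤ 1`, the negative binomial series dominates; it needs `t > 0`.
  refine (summable_choose_mul_geometric_of_norm_lt_one k hn).of_nonneg_of_le
    (weight_nonneg hπ ht.2) fun j => ?_
  rw [weight, add_comm k j, mul_assoc]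
  exact mul_le_of_le_one_left
    (mul_nonneg (Nat.cast_nonneg _) (pow_nonneg (sub_nonneg.2 ht.2) j)) (hπ.le_one _)

theorem summable_weight_mul (hπ : IsPrior π) (ht : t ∈ posteriorTimes π k) {a : ℕ → ℝ}
    (h0 : ∀ j, 0 ≤ a j) (h1 : ∀ j, a j ≤ 1) : Summable fun j => weight π k t j * a j :=
  ht.2.of_nonneg_of_le (fun j => mul_nonneg (weight_nonneg hπ ht.1.2 j) (h0 j))
    fun j => mul_le_of_le_one_right (weight_nonneg hπ ht.1.2 j) (h1 j)

theorem summable_weight_mul_s0 (hπ : IsPrior π) (hp : IsSuccessProfile p) (hk : 1 ≤ k)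
    (ht : t ∈ posteriorTimes π k) :
    Summable fun j => weight π k t j * s0 p (k + 1) (k + j) :=
  summable_weight_mul hπ ht (fun j => (s0_pos hp hk j).le) (s0_le_one hp hk)

theorem summable_weight_mul_s1 (hπ : IsPrior π) (hp : IsSuccessProfile p) (hk : 1 ≤ k)
    (ht : t ∈ posteriorTimes π k) :
    Summable fun j => weight π k t j * s1 p (k + 1) (k + j) :=
  summable_weight_mul hπ ht (s1_nonneg hp hk) (s1_le_one hp hk)

theorem tsum_weight_pos (hπ : IsPrior π) (hπk : 0 < π k) (ht : t ∈ posteriorTimes π k) :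
    0 < ∑' j, weight π k t j :=
  ht.2.tsum_pos (weight_nonneg hπ ht.1.2) 0 (by rwa [weight_zero])

theorem S0_eq_div : S0 π p t k =
    (∑' j, weight π k t j * s0 p (k + 1) (k + j)) / ∑' j, weight π k t j := by
  rw [S0, normalisation, mul_comm, div_eq_mul_inv]

theorem S1_eq (hπ : IsPrior π) (hp : IsSuccessProfile p) (hk : 1 ≤ k)
    (ht : t ∈ posteriorTimes π k) :
    S1 π p t k = normalisation π k t * ∑' j, weight π k t j * s1 p (k + 1) (k + j) := by
  rw [S1, (summable_weight_mul_s1 hπ hp hk ht).tsum_eq_zero_add, s1_zero, mul_zero, zero_add]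

/-- Covers both `t = 1` and a prior without mass above `k`. -/
theorem S0_eq_one_of_forall_weight (hπk : 0 < π k) (h : ∀ j ≠ 0, weight π k t j = 0) :
    S0 π p t k = 1 := by
  rw [S0_eq_div, tsum_eq_single 0 h, tsum_eq_single 0 (fun j hj => by rw [h j hj, zero_mul]),
    s0_zero, mul_one, weight_zero, div_self hπk.ne']

theorem S1_one_eq_zero : S1 π p 1 k = 0 := by simp [S1, weight]

theorem S0_lt_one (hπ : IsPrior π) (hp : IsSuccessProfile p) (hk : 1 ≤ k) (hπk : 0 < π k)
    (ht : t ∈ posteriorTimes π k) (ht1 : t < 1) {i : ℕ} (hi : i ≠ 0) (hπi : 0 < π (k + i)) :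
    S0 π p t k < 1 := by
  rw [S0_eq_div, div_lt_one (tsum_weight_pos hπ hπk ht)]
  refine Summable.tsum_lt_tsum (i := i)
    (fun j => mul_le_of_le_one_right (weight_nonneg hπ ht.1.2 j) (s0_le_one hp hk j)) ?_
    (summable_weight_mul_s0 hπ hp hk ht) ht.2
  refine mul_lt_of_lt_one_right (weight_pos hπi ht1) ?_
  exact (s0_strictAnti hp hk (Nat.pos_of_ne_zero hi)).trans_eq s0_zero

theorem hasSum_weight_mul_s0_sub (hπ : IsPrior π) (hp : IsSuccessProfile p) (hk : 1 ≤ k)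
    (hπk : 0 < π k) (ht : t ∈ posteriorTimes π k) (x : ℝ) :
    HasSum (fun j => weight π k t j * (s0 p (k + 1) (k + j) - x))
      ((S0 π p t k - x) * ∑' j, weight π k t j) := by
  have hW := (tsum_weight_pos hπ hπk ht).ne'
  rw [S0_eq_div, sub_mul, div_mul_cancel₀ _ hW]
  simpa only [mul_sub, mul_comm x] using
    (summable_weight_mul_s0 hπ hp hk ht).hasSum.sub (ht.2.hasSum.mul_right x)

theorem S0_strictMonoOn (hπ : IsPrior π) (hp : IsSuccessProfile p) (hk : 1 ≤ k) (hπk : 0 < π k)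
    {i : ℕ} (hi : i ≠ 0) (hπi : 0 < π (k + i)) :
    StrictMonoOn (fun t => S0 π p t k) (posteriorTimes π k) := by
  intro t ht t' ht' htt'
  have hlt := S0_lt_one hπ hp hk hπk ht (htt'.trans_le ht'.1.2) hi hπi
  have h := hasSum_weight_mul_s0_sub hπ hp hk hπk ht (S0 π p t k)
  have h' := hasSum_weight_mul_s0_sub hπ hp hk hπk ht' (S0 π p t k)
  -- Here `v = 1 - t` and `u = 1 - t'`; `hlt` supplies `e 0 > 0`. The value `v = 1` is allowed, so
  -- `t = 0` is covered when it belongs to the domain.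
  have hpos := tsum_pos_of_single_crossing (c := fun j => π (k + j) * ((k + j).choose k : ℝ))
    (e := fun j => s0 p (k + 1) (k + j) - S0 π p t k)
    (fun j => mul_nonneg (hπ.nonneg _) (Nat.cast_nonneg _))
    (fun a b hab => sub_le_sub_right ((s0_strictAnti hp hk).antitone hab) _)
    (by simpa using hπk) (by simpa only [s0_zero, sub_pos] using hlt)
    (sub_nonneg.2 ht'.1.2) (sub_lt_sub_left htt' 1) h'.summable h.summable
    (h.tsum_eq.trans (by rw [sub_self, zero_mul])).ge
  exact sub_pos.1 (pos_of_mul_pos_left (hpos.trans_eq h'.tsum_eq) (tsum_weight_pos hπ hπk ht').le)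

theorem exists_pos_of_tsum_pos (h : 0 < ∑' j : ℕ, π (k + 1 + j)) : ∃ i ≠ 0, 0 < π (k + i) := by
  by_contra! hcon
  refine h.not_ge (tsum_nonpos fun j => ?_)
  rw [add_assoc]
  exact hcon (1 + j) (by lia)

theorem S0_monotoneOn (hπ : IsPrior π) (hp : IsSuccessProfile p) (hk : 1 ≤ k) (hπk : 0 < π k) :
    MonotoneOn (fun t => S0 π p t k) (posteriorTimes π k) := by
  by_cases h : ∃ i ≠ 0, 0 < π (k + i)
  · obtain ⟨i, hi, hπi⟩ := h
    exact (S0_strictMonoOn hπ hp hk hπk hi hπi).monotoneOn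
  push Not at h
  have hone : ∀ t, S0 π p t k = 1 := fun t => S0_eq_one_of_forall_weight hπk fun j hj => by
    rw [weight, le_antisymm (h j hj) (hπ.nonneg _), zero_mul, zero_mul]
  intro t _ t' _ _
  simp only [hone, le_refl]

theorem exists_sign_S0_sub_S1 (hπ : IsPrior π) (hp : IsSuccessProfile p) (hk : 1 ≤ k)
    (hπk : 0 < π k) :
    ∃ a ∈ Set.Ico (0 : ℝ) 1, ∀ t ∈ Set.Ioc (0 : ℝ) 1,
      SignType.sign (S0 π p t k - S1 π p t k) = SignType.sign (t - a) := by
  -- The factor `s0` goes into `c`, leaving in `e` only the odds sum, which is monotone.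
  let c : ℕ → ℝ := fun j => π (k + j) * ((k + j).choose k : ℝ) * s0 p (k + 1) (k + j)
  let e : ℕ → ℝ := fun j => 1 - ∑ i ∈ Finset.Icc (k + 1) (k + j), p i / (1 - p i)
  have hsum : ∀ t ∈ Set.Ioc (0 : ℝ) 1, HasSum (fun j => c j * (1 - t) ^ j * e j)
      (∑' j, weight π k t j * s0 p (k + 1) (k + j) -
        ∑' j, weight π k t j * s1 p (k + 1) (k + j)) := by
    intro t ht
    have htD := Ioc_subset_posteriorTimes (k := k) hπ ht
    have heq : (fun j => c j * (1 - t) ^ j * e j) = fun j =>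
        weight π k t j * s0 p (k + 1) (k + j) - weight π k t j * s1 p (k + 1) (k + j) := by
      funext j
      simp only [c, e, weight, s1]
      ring
    rw [heq]
    exact (summable_weight_mul_s0 hπ hp hk htD).hasSum.sub
      (summable_weight_mul_s1 hπ hp hk htD).hasSum
  obtain ⟨b, hb, hsign⟩ := exists_sign_tsum_eq (c := c) (e := e)
    (fun j => mul_nonneg (mul_nonneg (hπ.nonneg _) (Nat.cast_nonneg _)) (s0_pos hp hk j).le)
    (fun i j hij => sub_le_sub_left (odds_monotone hp hk hij) 1)
    (by simpa [c, s0] using hπk) (by simp [e])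
    (fun u hu => by
      simpa using (hsum (1 - u) ⟨by linarith [hu.2], by linarith [hu.1]⟩).summable)
  refine ⟨1 - b, ⟨by linarith [hb.2], by linarith [hb.1]⟩, fun t ht => ?_⟩
  have htD := Ioc_subset_posteriorTimes (k := k) hπ ht
  have hs := hsign (1 - t) ⟨by linarith [ht.2], by linarith [ht.1]⟩
  rw [(hsum t ht).tsum_eq] at hs
  -- The normalisation is a positive common factor and does not affect the sign.
  rw [S1_eq hπ hp hk htD, S0, ← mul_sub, sign_mul, hs, normalisation,
    sign_pos (inv_pos.2 (tsum_weight_pos hπ hπk htD)), one_mul]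
  congr 1
  ring

end Posterior

end LastSuccess

theorem mainTheorem7 (π p : ℕ → ℝ) (hπ : LastSuccess.IsPrior π)
    (hp : LastSuccess.IsSuccessProfile p) (k : ℕ) (hk : 1 ≤ k) (hπk : 0 < π k) :
    -- the posterior, `S0` and `S1` are given by convergent series, for all `t ∈ (0, 1]` at least
    (Set.Ioc (0 : ℝ) 1 ⊆ LastSuccess.posteriorTimes π k ∧
      ∀ t ∈ LastSuccess.posteriorTimes π k,
        Summable (fun j : ℕ => LastSuccess.weight π k t j * LastSuccess.s0 p (k + 1) (k + j)) ∧
        Summable (fun j : ℕ =>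
          LastSuccess.weight π k t (j + 1) * LastSuccess.s1 p (k + 1) (k + (j + 1)))) ∧
    (LastSuccess.S0 π p 1 k = 1 ∧ LastSuccess.S1 π p 1 k = 0) ∧
    (MonotoneOn (fun t : ℝ => LastSuccess.S0 π p t k) (LastSuccess.posteriorTimes π k) ∧
      (0 < ∑' j : ℕ, π (k + 1 + j) →
        StrictMonoOn (fun t : ℝ => LastSuccess.S0 π p t k) (LastSuccess.posteriorTimes π k))) ∧
    (∃ a : ℝ, a ∈ Set.Ico (0 : ℝ) 1 ∧ ∀ t ∈ Set.Ioc (0 : ℝ) 1,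
      SignType.sign (LastSuccess.S0 π p t k - LastSuccess.S1 π p t k) =
        SignType.sign (t - a)) := by
  refine ⟨⟨LastSuccess.Ioc_subset_posteriorTimes hπ, fun t ht =>
      ⟨LastSuccess.summable_weight_mul_s0 hπ hp hk ht,
        (summable_nat_add_iff 1).2 (LastSuccess.summable_weight_mul_s1 hπ hp hk ht)⟩⟩,
    ⟨LastSuccess.S0_eq_one_of_forall_weight hπk fun j hj => by simp [LastSuccess.weight, hj],
      LastSuccess.S1_one_eq_zero⟩,
    ⟨LastSuccess.S0_monotoneOn hπ hp hk hπk, fun h => ?_⟩,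
    LastSuccess.exists_sign_S0_sub_S1 hπ hp hk hπk⟩
  obtain ⟨i, hi, hπi⟩ := LastSuccess.exists_pos_of_tsum_pos h
  exact LastSuccess.S0_strictMonoOn hπ hp hk hπk hi hπi
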